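/- **Setting.** A *functorial normed chain complex* is a functor $F$ from topological spaces and continuous maps to $\mathbb N$-graded chain complexes of normed real vector spaces with continuous boundary operators, such that every continuous map induces a chain map of norm at most $1$. Let $C_*(\,\cdot\,;\mathbb R)$ be the singular chain complex functor with the $\ell^1$-norm with respect to singular simplices. A *normed model* $(F,\varphi,\psi)$ of $C_*(\,\cdot\,;\mathbb R)$ consists of a functorial normed chain complex $F$ and natural chain maps $\varphi\colon F\Rightarrow C_*(\,\cdot\,;\mathbb R)$, $\psi\colon C_*(\,\cdot\,;\mathbb R)\Rightarrow F$, continuous in every degree on every space, such that $\psi\circ\varphi$ and $\varphi\circ\psi$ are homotopic to the identity through natural linear chain homotopies that are continuous in every degree. For a pair $(X,A)$ with inclusion $i\colon A\hookrightarrow X$ let $F(X,A)=F(X)/F(i)(F(A))$ with the quotient semi-norm $|\cdot|^F$, and let $F^{\mathrm{lf}}(X)=\varprojlim_{K} F(X,X\setminus K)$, where $K$ ranges over the compact subsets of $X$ (directed by inclusion). For $c=(c_K)_K\in F^{\mathrm{lf}}_n(X)$ put $|c|^F=\inf\lim_K|b_K|^F\in[0,\infty]$, where the infimum is over all families $(b_K)_K$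 in $F_n(X)$ that are Cauchy with respect to $|\cdot|^F$ and for which every $b_K$ represents $c_K$ (so $|c|^F=\infty$ if there is no such family). The complex $C^{\mathrm{lf}}_*(X;\mathbb R)=\varprojlim_K C_*(X,X\setminus K;\mathbb R)$ of locally finite singular chains carries the $\ell^1$-norm $|\cdot|_1\in[0,\infty]$, the sum of the absolute values of all coefficients. The maps induced by $\varphi$ and $\psi$ on these complexes are denoted by $\varphi^{(X,A)},\psi^{(X,A)},\varphi^{\mathrm{lf},X},\psi^{\mathrm{lf},X}$, and $\|\cdot\|$ denotes operator norms. Manifolds are topological manifolds (Hausdorff, second countable). For an oriented compact $n$-manifold $M$ with (possibly empty) boundary and real fundamental class $[M,\partial M]_{\mathbb R}\in H_n(M,\partial M;\mathbb R)$, let $\|M,\partial M\|$ be the infimum of the norms of all relative singular cycles in $C_n(M,\partial M;\mathbb R)$ that represent $[M,\partial M]_{\mathbb R}$, and let $\|M,\partial M\|^F$ be the infimum of $|c|^F$ over all cycles $c\in F_n(M,\partial M)$ that represent $H_n(\psi^{(M,\partial M)})([M,\partial M]_{\mathbb R})$. For an oriented $n$-manifold $M$ without boundary (compact or not) and locally finite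 real fundamental class $[M]^{\mathrm{lf}}_{\mathbb R}\in H_n^{\mathrm{lf}}(M;\mathbb R)$, let $\|M\|_{\mathrm{lf}}\in[0,\infty]$ be the infimum of $|c|_1$ over all cycles $c\in C^{\mathrm{lf}}_n(M;\mathbb R)$ that represent $[M]^{\mathrm{lf}}_{\mathbb R}$, and let $\|M\|^F_{\mathrm{lf}}\in[0,\infty]$ be the infimum of $|c|^F$ over all cycles $c\in F^{\mathrm{lf}}_n(M)$ that represent $H_n(\psi^{\mathrm{lf},M})([M]^{\mathrm{lf}}_{\mathbb R})$. **Proposition.** Let $(F,\varphi,\psi)$ be a normed model of $C_*(\,\cdot\,;\mathbb R)$ and let $n\in\mathbb N$. Let $\|\psi_n^{\Delta^n}\|$ be the operator norm of $\psi_n^{\Delta^n}\colon C_n(\Delta^n;\mathbb R)\to F_n(\Delta^n)$, where $\Delta^n$ is the standard $n$-simplex. 1. For all oriented compact $n$-manifolds $M$ we have $$\|M,\partial M\|^F\le\|\psi_n^{\Delta^n}\|\cdot\|M,\partial M\|\quad\text{and}\quad\|M,\partial M\|\le\|\varphi_n^{(M,\partial M)}\|\cdot\|M,\partial M\|^F .$$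 2. For all oriented $n$-manifolds $M$ without boundary, the operator norm $\|\varphi_n^{\mathrm{lf},M}\|$ of $\varphi_n^{\mathrm{lf},M}\colon F_n^{\mathrm{lf}}(M)\to C_n^{\mathrm{lf}}(M;\mathbb R)$ is finite, and $$\|M\|^F_{\mathrm{lf}}\le\|\psi_n^{\Delta^n}\|\cdot\|M\|_{\mathrm{lf}}\quad\text{and}\quad\|M\|_{\mathrm{lf}}\le\|\varphi_n^{\mathrm{lf},M}\|\cdot\|M\|^F_{\mathrm{lf}} .$$ -/

import Mathlib

open scoped ENNReal Topology

universe u v v' w w'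

set_option linter.checkUnivs false

noncomputable section

namespace NormedModels

/-! ## Chain complexes and their homology -/

/-- An `ℕ`-graded chain complex of `R`-modules. -/
structure Cplx (R : Type) [Ring R] where
  V : ℕ → Type w
  [addCommGroup : ∀ n, AddCommGroup (V n)]
  [module : ∀ n, Module R (V n)]
  /-- the boundary operator from degree `n + 1` to degree `n` -/
  d : ∀ n, V (n + 1) →ₗ[R] V n
  d_d : ∀ n c, d n (d (n + 1) c) = 0

attribute [instance] Cplx.addCommGroup Cplx.module

namespace Cplx

variable {R S : Type} [Ring R] [Ring S]

/-- The cycles in degree `n`; every chain of degree `0` is a cycle. -/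
def cycles (K : Cplx.{w} R) : ∀ n, Submodule R (K.V n)
  | 0 => ⊤
  | n + 1 => LinearMap.ker (K.d n)

/-- The boundaries in degree `n`. -/
def boundaries (K : Cplx.{w} R) (n : ℕ) : Submodule R (K.V n) := LinearMap.range (K.d n)

/-- The homology `H_n`, that is, cycles modulo boundaries. -/
abbrev Homology (K : Cplx.{w} R) (n : ℕ) : Type w :=
  K.cycles n ⧸ (K.boundaries n).submoduleOf (K.cycles n)

/-- The homology class of a cycle. -/
def classOf (K : Cplx.{w} R) (n : ℕ) (c : K.cycles n) : K.Homology n :=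
  ((K.boundaries n).submoduleOf (K.cycles n)).mkQ c

/-- Chain maps, possibly semilinear with respect to a change of rings `τ`. -/
structure Hom (τ : R →+* S) (K : Cplx.{w} R) (L : Cplx.{w'} S) where
  f : ∀ n, K.V n →ₛₗ[τ] L.V n
  comm : ∀ n c, L.d n (f (n + 1) c) = f n (K.d n c)

variable {τ : R →+* S} {K : Cplx.{w} R} {L : Cplx.{w'} S}

theorem Hom.mapsTo_cycles (g : Hom τ K L) :
    ∀ (n : ℕ) (c : K.V n), c ∈ K.cycles n → g.f n c ∈ L.cycles n
  | 0, _, _ => Submodule.mem_top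
  | n + 1, c, hc => by
    have hc' : K.d n c = 0 := hc
    change L.d n (g.f (n + 1) c) = 0
    rw [g.comm, hc', map_zero]

/-- The map induced by a chain map on cycles. -/
def Hom.mapCycles (g : Hom τ K L) (n : ℕ) : K.cycles n →ₛₗ[τ] L.cycles n :=
  (g.f n).restrict (g.mapsTo_cycles n)

/-- The map `H_n(g)` induced by a chain map `g` on homology. -/
def Hom.mapHomology (g : Hom τ K L) (n : ℕ) : K.Homology n →ₛₗ[τ] L.Homology n :=
  Submodule.mapQ _ _ (g.mapCycles n) (by
    rintro c ⟨b, hb⟩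
    refine ⟨g.f (n + 1) b, ?_⟩
    rw [g.comm, hb]
    rfl)

/-- The (possibly infinite) semi-norm on `H_n(K)` induced by a function `p` on `n`-chains:
the infimum of `p` over all cycles that represent the given class. -/
def homologyNorm (K : Cplx.{w} R) (n : ℕ) (p : K.V n → ℝ≥0∞) (α : K.Homology n) : ℝ≥0∞ :=
  ⨅ (c : K.cycles n) (_ : K.classOf n c = α), p c

end Cplx

/-! ## Functorial chain complexes, pairs of spaces, and locally finite versions -/

/-- The inclusion of a subspace. -/
def incl {X : Type u} [TopologicalSpace X] (A : Set X) : C(A, X) := ⟨Subtype.val, by fun_prop⟩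

/-- The inclusion of a subspace into a larger subspace. -/
def inclIncl {X : Type u} [TopologicalSpace X] {A B : Set X} (h : A ⊆ B) : C(A, B) :=
  ⟨Set.inclusion h, continuous_inclusion h⟩

/-- A functor from topological spaces and continuous maps to chain complexes of `R`-modules. -/
structure FunctorialCplx (R : Type) [Ring R] where
  obj : (X : Type u) → [TopologicalSpace X] → ℕ → Type v
  [addCommGroup : ∀ (X : Type u) [TopologicalSpace X] (n : ℕ), AddCommGroup (obj X n)]
  [module : ∀ (X : Type u) [TopologicalSpace X] (n : ℕ), Module R (obj X n)]
  d : ∀ (X : Type u) [TopologicalSpace X] (n : ℕ), obj X (n + 1) →ₗ[R] obj X n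
  d_d : ∀ (X : Type u) [TopologicalSpace X] (n : ℕ) (c : obj X (n + 2)),
    d X n (d X (n + 1) c) = 0
  map : ∀ {X Y : Type u} [TopologicalSpace X] [TopologicalSpace Y] (_ : C(X, Y)) (n : ℕ),
    obj X n →ₗ[R] obj Y n
  map_d : ∀ {X Y : Type u} [TopologicalSpace X] [TopologicalSpace Y] (f : C(X, Y)) (n : ℕ)
    (c : obj X (n + 1)), d Y n (map f (n + 1) c) = map f n (d X n c)
  map_id : ∀ (X : Type u) [TopologicalSpace X] (n : ℕ) (c : obj X n),
    map (ContinuousMap.id X) n c = c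
  map_comp : ∀ {X Y Z : Type u} [TopologicalSpace X] [TopologicalSpace Y] [TopologicalSpace Z]
    (g : C(Y, Z)) (f : C(X, Y)) (n : ℕ) (c : obj X n),
    map (g.comp f) n c = map g n (map f n c)

attribute [instance] FunctorialCplx.addCommGroup FunctorialCplx.module

namespace FunctorialCplx

variable {R S : Type} [Ring R] [Ring S] (F : FunctorialCplx.{u, v} R)
variable (X : Type u) [TopologicalSpace X]

/-- The image of `F_n(A)` in `F_n(X)` under the map induced by the inclusion. -/
def sub (A : Set X) (n : ℕ) : Submodule R (F.obj X n) := LinearMap.range (F.map (incl A) n)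

/-- The relative chains `F_n(X, A) = F_n(X) / F(i)(F_n(A))`. -/
abbrev Rel (A : Set X) (n : ℕ) : Type v := F.obj X n ⧸ F.sub X A n

variable {X}

theorem sub_mono {A B : Set X} (h : A ⊆ B) (n : ℕ) : F.sub X A n ≤ F.sub X B n := by
  rintro _ ⟨c, rfl⟩
  exact ⟨F.map (inclIncl h) n c, (F.map_comp (incl B) (inclIncl h) n c).symm⟩

theorem d_mem_sub (A : Set X) (n : ℕ) (c : F.obj X (n + 1)) (hc : c ∈ F.sub X A (n + 1)) :
    F.d X n c ∈ F.sub X A n := by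
  obtain ⟨b, rfl⟩ := hc
  exact ⟨F.d A n b, (F.map_d (incl A) n b).symm⟩

/-- The boundary operator of `F(X, A)`. -/
def relD (A : Set X) (n : ℕ) : F.Rel X A (n + 1) →ₗ[R] F.Rel X A n :=
  Submodule.mapQ _ _ (F.d X n) (F.d_mem_sub A n)

/-- The chain complex `F(X, A)` of a pair of spaces. -/
def relCplx (A : Set X) : Cplx.{v} R where
  V := F.Rel X A
  d := F.relD A
  d_d n c := by
    obtain ⟨b, rfl⟩ := Submodule.Quotient.mk_surjective _ c
    simp [relD, F.d_d]

/-- The map `F_n(X, A) → F_n(X, B)` induced by the identity of `X`, for `A ⊆ B`. -/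
def relIncl {A B : Set X} (h : A ⊆ B) (n : ℕ) : F.Rel X A n →ₗ[R] F.Rel X B n :=
  Submodule.mapQ _ _ LinearMap.id (F.sub_mono h n)

theorem relD_relIncl {A B : Set X} (h : A ⊆ B) (n : ℕ) (c : F.Rel X A (n + 1)) :
    F.relD B n (F.relIncl h (n + 1) c) = F.relIncl h n (F.relD A n c) := by
  obtain ⟨b, rfl⟩ := Submodule.Quotient.mk_surjective _ c
  rfl

/-- The chain map `F(X, A) → F(X, B)` induced by the identity of `X`, for `A ⊆ B`. -/
def relInclHom {A B : Set X} (h : A ⊆ B) : Cplx.Hom (RingHom.id R) (F.relCplx A) (F.relCplx B) where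
  f := F.relIncl h
  comm := F.relD_relIncl h

variable (X)

/-- The locally finite chains of degree `n`: the inverse limit of the modules `F_n(X, X \ K)` over
all compact subsets `K` of `X`. -/
def LF (n : ℕ) : Submodule R (∀ K : TopologicalSpace.Compacts X, F.Rel X (K : Set X)ᶜ n) where
  carrier := {c | ∀ (K L : TopologicalSpace.Compacts X) (h : (K : Set X) ⊆ L),
    F.relIncl (Set.compl_subset_compl.mpr h) n (c L) = c K}
  add_mem' hc hc' K L h := by
    simp only [Pi.add_apply, map_add, hc K L h, hc' K L h]
  zero_mem' K L h := by simp
  smul_mem' r c hc K L h := by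
    simp only [Pi.smul_apply, map_smul, hc K L h]

variable {X}

/-- The boundary operator on locally finite chains, given componentwise. -/
def lfD (n : ℕ) : F.LF X (n + 1) →ₗ[R] F.LF X n where
  toFun c := ⟨fun K => F.relD (K : Set X)ᶜ n (c.1 K), fun K L h => by
    rw [← F.relD_relIncl, c.2 K L h]⟩
  map_add' c c' := Subtype.ext (funext fun K => map_add _ (c.1 K) (c'.1 K))
  map_smul' r c := Subtype.ext (funext fun K => map_smul _ r (c.1 K))

variable (X)

/-- The chain complex `F^lf(X)`. -/
def lfCplx : Cplx.{max u v} R where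
  V n := F.LF X n
  d := F.lfD
  d_d n c := Subtype.ext (funext fun K => (F.relCplx (K : Set X)ᶜ).d_d n (c.1 K))

variable {X}

/-- The projection of locally finite chains to `F(X, X \ K)`, for `K` compact. -/
def lfProj (K : TopologicalSpace.Compacts X) :
    Cplx.Hom (RingHom.id R) (F.lfCplx X) (F.relCplx (K : Set X)ᶜ) where
  f n := (LinearMap.proj K).comp (F.LF X n).subtype
  comm _ _ := rfl

end FunctorialCplx

/-! ## Functorial normed chain complexes and normed models -/

/-- A functor from topological spaces to normed real chain complexes: the chain modules are normed
spaces, the boundary operators are continuous (equivalently, bounded), and continuous maps of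
spaces induce chain maps of norm at most `1`. -/
structure FunctorialNormedCplx extends FunctorialCplx.{u, v} ℝ where
  [norm : ∀ (X : Type u) [TopologicalSpace X] (n : ℕ), Norm (obj X n)]
  core : ∀ (X : Type u) [TopologicalSpace X] (n : ℕ), NormedSpace.Core ℝ (obj X n)
  d_bounded : ∀ (X : Type u) [TopologicalSpace X] (n : ℕ),
    ∃ C : ℝ, ∀ c : obj X (n + 1), ‖d X n c‖ ≤ C * ‖c‖
  norm_map_le : ∀ {X Y : Type u} [TopologicalSpace X] [TopologicalSpace Y] (f : C(X, Y)) (n : ℕ)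
    (c : obj X n), ‖map f n c‖ ≤ ‖c‖

instance (F : FunctorialNormedCplx.{u, v}) (X : Type u) [TopologicalSpace X] (n : ℕ) :
    NormedAddCommGroup (F.obj X n) :=
  letI := F.norm X n
  NormedAddCommGroup.ofCore (F.core X n)

instance (F : FunctorialNormedCplx.{u, v}) (X : Type u) [TopologicalSpace X] (n : ℕ) :
    NormedSpace ℝ (F.obj X n) :=
  letI := F.norm X n
  NormedSpace.ofCore (F.core X n)

/-- A natural chain map, continuous in every degree and on every space. -/
structure NatContChainMap (F : FunctorialNormedCplx.{u, v}) (G : FunctorialNormedCplx.{u, v'}) where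
  app : ∀ (X : Type u) [TopologicalSpace X] (n : ℕ), F.obj X n →L[ℝ] G.obj X n
  comm : ∀ (X : Type u) [TopologicalSpace X] (n : ℕ) (c : F.obj X (n + 1)),
    G.d X n (app X (n + 1) c) = app X n (F.d X n c)
  naturality : ∀ {X Y : Type u} [TopologicalSpace X] [TopologicalSpace Y] (f : C(X, Y)) (n : ℕ)
    (c : F.obj X n), app Y n (F.map f n c) = G.map f n (app X n c)

namespace NatContChainMap

variable {F : FunctorialNormedCplx.{u, v}} {G : FunctorialNormedCplx.{u, v'}}

/-- The identity. -/
def id (F : FunctorialNormedCplx.{u, v}) : NatContChainMap F F where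
  app _ _ _ := ContinuousLinearMap.id ℝ _
  comm _ _ _ _ := rfl
  naturality _ _ _ := rfl

/-- Composition; `η.comp θ` is "first `θ`, then `η`". -/
def comp {H : FunctorialNormedCplx.{u, w}} (η : NatContChainMap G H) (θ : NatContChainMap F G) :
    NatContChainMap F H where
  app X _ n := (η.app X n).comp (θ.app X n)
  comm X _ n c := by simp [η.comm, θ.comm]
  naturality f n c := by simp [η.naturality, θ.naturality]

variable (η : NatContChainMap F G) {X : Type u} [TopologicalSpace X]

theorem app_mem_sub (A : Set X) (n : ℕ) (c : F.obj X n) (hc : c ∈ F.sub X A n) :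
    η.app X n c ∈ G.sub X A n := by
  obtain ⟨b, rfl⟩ := hc
  exact ⟨η.app A n b, (η.naturality (incl A) n b).symm⟩

/-- The continuous linear map `η_n^{(X, A)} : F_n(X, A) → G_n(X, A)` induced by `η_n^X`. Here the
relative chain modules carry the quotient semi-norms. -/
def relApp (A : Set X) (n : ℕ) : F.Rel X A n →L[ℝ] G.Rel X A n :=
  (F.sub X A n).liftQL ((G.sub X A n).mkQL.comp (η.app X n)) (by
    intro c hc
    have h : η.app X n c ∈ G.sub X A n := η.app_mem_sub A n c hc
    simpa using h)

theorem relD_relApp (A : Set X) (n : ℕ) (c : F.Rel X A (n + 1)) :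
    G.relD A n (η.relApp A (n + 1) c) = η.relApp A n (F.relD A n c) := by
  obtain ⟨b, rfl⟩ := Submodule.Quotient.mk_surjective _ c
  exact congrArg (G.sub X A n).mkQ (η.comm X n b)

theorem relIncl_relApp {A B : Set X} (h : A ⊆ B) (n : ℕ) (c : F.Rel X A n) :
    G.relIncl h n (η.relApp A n c) = η.relApp B n (F.relIncl h n c) := by
  obtain ⟨b, rfl⟩ := Submodule.Quotient.mk_surjective _ c
  rfl

/-- The chain map `η^{(X, A)} : F(X, A) → G(X, A)`. -/
def relHom (A : Set X) : Cplx.Hom (RingHom.id ℝ) (F.relCplx A) (G.relCplx A) where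
  f n := (η.relApp A n).toLinearMap
  comm := η.relD_relApp A

variable (X)

/-- The linear map `η_n^{lf,X} : F^lf_n(X) → G^lf_n(X)` induced by `η_n^X`. -/
def lfApp (n : ℕ) : F.LF X n →ₗ[ℝ] G.LF X n where
  toFun c := ⟨fun K => η.relApp (K : Set X)ᶜ n (c.1 K), fun K L h =>
    (η.relIncl_relApp _ n (c.1 L)).trans (congrArg (η.relApp (K : Set X)ᶜ n) (c.2 K L h))⟩
  map_add' c c' := Subtype.ext (funext fun K => map_add _ (c.1 K) (c'.1 K))
  map_smul' r c := Subtype.ext (funext fun K => map_smul _ r (c.1 K))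

/-- The chain map `η^{lf,X} : F^lf(X) → G^lf(X)`. -/
def lfHom : Cplx.Hom (RingHom.id ℝ) (F.lfCplx X) (G.lfCplx X) where
  f := η.lfApp X
  comm n c := Subtype.ext (funext fun K => η.relD_relApp (K : Set X)ᶜ n (c.1 K))

end NatContChainMap

/-- A natural normed chain homotopy between natural continuous chain maps: a natural family of
linear chain homotopies that are continuous in every degree. -/
structure NatNormedHomotopy {F : FunctorialNormedCplx.{u, v}} {G : FunctorialNormedCplx.{u, v'}}
    (η θ : NatContChainMap F G) where
  h : ∀ (X : Type u) [TopologicalSpace X] (n : ℕ), F.obj X n →L[ℝ] G.obj X (n + 1)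
  homotopy_zero : ∀ (X : Type u) [TopologicalSpace X] (c : F.obj X 0),
    G.d X 0 (h X 0 c) = η.app X 0 c - θ.app X 0 c
  homotopy_succ : ∀ (X : Type u) [TopologicalSpace X] (n : ℕ) (c : F.obj X (n + 1)),
    G.d X (n + 1) (h X (n + 1) c) + h X n (F.d X n c) = η.app X (n + 1) c - θ.app X (n + 1) c
  naturality : ∀ {X Y : Type u} [TopologicalSpace X] [TopologicalSpace Y] (f : C(X, Y)) (n : ℕ)
    (c : F.obj X n), h Y n (F.map f n c) = G.map f (n + 1) (h X n c)

/-! ## The singular chain complex -/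

/-- The topological standard simplex of dimension `n`. -/
abbrev Simp (n : ℕ) : Type := stdSimplex ℝ (Fin (n + 1))

/-- The inclusion of the face of the standard `(n + 1)`-simplex opposite to the vertex `i`. -/
def face (n : ℕ) (i : Fin (n + 2)) : C(Simp n, Simp (n + 1)) :=
  ⟨stdSimplex.map i.succAbove, stdSimplex.continuous_map _⟩

/-- Singular `n`-simplices. -/
abbrev SingSimplex (X : Type u) [TopologicalSpace X] (n : ℕ) : Type u := C(Simp n, X)

/-- The singular boundary operator. -/
def singD (R : Type) [Ring R] (X : Type u) [TopologicalSpace X] (n : ℕ) :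
    (SingSimplex X (n + 1) →₀ R) →ₗ[R] (SingSimplex X n →₀ R) :=
  ∑ i : Fin (n + 2), (-1 : ℤ) ^ (i : ℕ) •
    Finsupp.lmapDomain R R fun σ : SingSimplex X (n + 1) => σ.comp (face n i)

theorem face_face (n : ℕ) (i : Fin (n + 3)) (j : Fin (n + 2)) :
    (face (n + 1) (i.succAbove j)).comp (face n (j.predAbove i)) =
      (face (n + 1) i).comp (face n j) := by
  ext1 x
  have h : (i.succAbove j).succAbove ∘ (j.predAbove i).succAbove = i.succAbove ∘ j.succAbove :=
    funext fun k => Fin.succAbove_succAbove_succAbove_predAbove i j k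
  simp [face, stdSimplex.map_comp_apply, h]

theorem singD_single (R : Type) [Ring R] (X : Type u) [TopologicalSpace X] (n : ℕ)
    (σ : SingSimplex X (n + 1)) (r : R) :
    singD R X n (Finsupp.single σ r) =
      ∑ i : Fin (n + 2), (-1 : ℤ) ^ (i : ℕ) • Finsupp.single (σ.comp (face n i)) r := by
  simp [singD, LinearMap.sum_apply, Finsupp.mapDomain_single]

theorem singD_singD (R : Type) [Ring R] (X : Type u) [TopologicalSpace X] (n : ℕ)
    (c : SingSimplex X (n + 2) →₀ R) : singD R X n (singD R X (n + 1) c) = 0 := by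
  induction c using Finsupp.induction_linear with
  | zero => simp
  | add c c' hc hc' => simp [hc, hc']
  | single σ r =>
    simp only [singD_single, map_sum, map_zsmul, Finset.smul_sum, smul_smul]
    rw [← Finset.sum_product' Finset.univ Finset.univ
      (fun (i : Fin (n + 3)) (j : Fin (n + 2)) => ((-1 : ℤ) ^ (i : ℕ) * (-1 : ℤ) ^ (j : ℕ)) •
        Finsupp.single ((σ.comp (face (n + 1) i)).comp (face n j)) r)]
    refine Finset.sum_involution (fun p _ => (p.1.succAbove p.2, p.2.predAbove p.1)) ?_ ?_ ?_ ?_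
    · rintro ⟨i, j⟩ -
      have h := Fin.neg_one_pow_succAbove_add_predAbove (R := ℤ) i j
      have e : (σ.comp (face (n + 1) (i.succAbove j))).comp (face n (j.predAbove i)) =
          (σ.comp (face (n + 1) i)).comp (face n j) := by
        rw [ContinuousMap.comp_assoc, face_face, ContinuousMap.comp_assoc]
      simp only [e, ← pow_add, h, ← add_smul]
      simp
    · rintro ⟨i, j⟩ - _ h
      exact Fin.succAbove_ne i j (congrArg Prod.fst h)
    · simp
    · rintro ⟨i, j⟩ -
      simp [Fin.succAbove_succAbove_predAbove, Fin.predAbove_predAbove_succAbove]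

/-- The singular chain complex functor `C_*( · ; R)`. -/
def singular (R : Type) [Ring R] : FunctorialCplx.{u, u} R where
  obj X _ n := SingSimplex X n →₀ R
  d X _ n := singD R X n
  d_d X _ n c := singD_singD R X n c
  map f n := Finsupp.lmapDomain R R fun σ => f.comp σ
  map_d f n c := by
    induction c using Finsupp.induction_linear with
    | zero => simp
    | add c c' hc hc' => simp only [map_add, hc, hc']
    | single σ r =>
      simp only [singD_single, Finsupp.lmapDomain_apply, Finsupp.mapDomain_single,
        ContinuousMap.comp_assoc, map_sum, map_zsmul]
  map_id X _ n c := by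
    induction c using Finsupp.induction_linear with
    | zero => simp
    | add c c' hc hc' => simp only [map_add, hc, hc']
    | single σ r => simp [Finsupp.mapDomain_single]
  map_comp g f n c := by
    induction c using Finsupp.induction_linear with
    | zero => simp
    | add c c' hc hc' => simp only [map_add, hc, hc']
    | single σ r => simp [Finsupp.mapDomain_single, ContinuousMap.comp_assoc]

/-- The `ℓ¹`-norm of a finite chain. -/
def l1 {ι : Type u} (c : ι →₀ ℝ) : ℝ := c.sum fun _ a => |a|

theorem l1_eq_sum {ι : Type u} (c : ι →₀ ℝ) {s : Finset ι} (hs : c.support ⊆ s) :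
    l1 c = ∑ i ∈ s, |c i| :=
  Finsupp.sum_of_support_subset _ hs _ (by simp)

theorem l1_add_le {ι : Type u} (c c' : ι →₀ ℝ) : l1 (c + c') ≤ l1 c + l1 c' := by
  classical
  rw [l1_eq_sum (c + c') Finsupp.support_add, l1_eq_sum c Finset.subset_union_left,
    l1_eq_sum c' Finset.subset_union_right, ← Finset.sum_add_distrib]
  exact Finset.sum_le_sum fun i _ => abs_add_le _ _

theorem l1_smul {ι : Type u} (r : ℝ) (c : ι →₀ ℝ) : l1 (r • c) = |r| * l1 c := by
  rw [l1_eq_sum (r • c) Finsupp.support_smul, l1_eq_sum c subset_rfl, Finset.mul_sum]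
  simp [abs_mul]

theorem l1_single {ι : Type u} (i : ι) (r : ℝ) : l1 (Finsupp.single i r) = |r| := by
  simp [l1]

theorem l1_core (ι : Type u) :
    letI : Norm (ι →₀ ℝ) := ⟨l1⟩
    NormedSpace.Core ℝ (ι →₀ ℝ) :=
  letI : Norm (ι →₀ ℝ) := ⟨l1⟩
  { norm_nonneg := fun c => Finset.sum_nonneg fun _ _ => abs_nonneg _
    norm_smul := fun r c => l1_smul r c
    norm_triangle := l1_add_le
    norm_eq_zero_iff := fun c => by
      change l1 c = 0 ↔ c = 0
      refine ⟨fun h => ?_, fun h => by simp [h, l1]⟩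
      ext i
      by_contra hi
      have h' := (Finset.sum_eq_zero_iff_of_nonneg fun _ _ => abs_nonneg _).1 h i
        (Finsupp.mem_support_iff.2 hi)
      exact hi (abs_eq_zero.1 h') }

/-- A linear map that is bounded by `C` on basis elements is bounded by `C`. -/
theorem l1_map_le {ι : Type u} {κ : Type v} (f : (ι →₀ ℝ) →ₗ[ℝ] (κ →₀ ℝ)) (C : ℝ)
    (h : ∀ i r, l1 (f (Finsupp.single i r)) ≤ C * |r|) (c : ι →₀ ℝ) : l1 (f c) ≤ C * l1 c := by
  have hs : ∀ s : Finset ι, l1 (f (∑ i ∈ s, Finsupp.single i (c i))) ≤ C * ∑ i ∈ s, |c i| := by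
    classical
    intro s
    induction s using Finset.induction_on with
    | empty => simp [l1]
    | insert i s hi ih =>
      rw [Finset.sum_insert hi, Finset.sum_insert hi, map_add, mul_add]
      exact (l1_add_le _ _).trans (add_le_add (h _ _) ih)
  have := hs c.support
  rwa [show ∑ i ∈ c.support, Finsupp.single i (c i) = c from c.sum_single] at this

theorem l1_singD_single (X : Type u) [TopologicalSpace X] (n : ℕ) (σ : SingSimplex X (n + 1))
    (r : ℝ) : l1 (singD ℝ X n (Finsupp.single σ r)) ≤ (n + 2) * |r| := by
  have hs : ∀ s : Finset (Fin (n + 2)), l1 (∑ i ∈ s, (-1 : ℤ) ^ (i : ℕ) •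
      Finsupp.single (σ.comp (face n i)) r) ≤ s.card * |r| := by
    classical
    intro s
    induction s using Finset.induction_on with
    | empty => simp [l1]
    | insert i s hi ih =>
      rw [Finset.sum_insert hi, Finset.card_insert_of_notMem hi]
      refine (l1_add_le _ _).trans ?_
      have : l1 ((-1 : ℤ) ^ (i : ℕ) • Finsupp.single (σ.comp (face n i)) r) = |r| := by
        rcases neg_one_pow_eq_or ℤ (i : ℕ) with h | h
        · rw [h, one_smul, l1_single]
        · rw [h, neg_one_smul, ← Finsupp.single_neg, l1_single, abs_neg]
      rw [this]
      push_cast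
      linarith
  rw [singD_single]
  simpa using hs Finset.univ

/-- The real singular chain complex functor `C_*( · ; ℝ)`, with the `ℓ¹`-norm with respect to the
basis of singular simplices. -/
def singularNormed : FunctorialNormedCplx.{u, u} where
  toFunctorialCplx := singular ℝ
  norm X _ n := ⟨fun c : SingSimplex X n →₀ ℝ => l1 c⟩
  core X _ n := l1_core (SingSimplex X n)
  d_bounded X _ n := ⟨n + 2, l1_map_le (singD ℝ X n) _ (l1_singD_single X n)⟩
  norm_map_le {X Y} _ _ f n c := by
    have := l1_map_le (Finsupp.lmapDomain ℝ ℝ fun σ : SingSimplex X n => f.comp σ) 1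
      (fun σ r => by simp [Finsupp.mapDomain_single, l1_single]) c
    rwa [one_mul] at this

/-- A normed model `(F, φ, ψ)` of the singular chain complex. -/
structure NormedModel where
  F : FunctorialNormedCplx.{u, v}
  φ : NatContChainMap F singularNormed.{u}
  ψ : NatContChainMap singularNormed.{u} F
  ψ_φ : Nonempty (NatNormedHomotopy (ψ.comp φ) (NatContChainMap.id F))
  φ_ψ : Nonempty (NatNormedHomotopy (φ.comp ψ) (NatContChainMap.id singularNormed.{u}))

/-! ## Norms of locally finite chains -/

section LocallyFinite

variable (X : Type u) [TopologicalSpace X]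

/-- The norm of `c = (c_K)_K ∈ F^lf_n(X)`: the infimum of `lim_K |b_K|` over all families
`(b_K)_K` in `F_n(X)` that are Cauchy with respect to the norm and for which `b_K` represents
`c_K` for every compact `K`. It is `∞` if there is no such family. -/
def lfNorm (F : FunctorialNormedCplx.{u, v}) (n : ℕ) (c : F.LF X n) : ℝ≥0∞ :=
  sInf {L | ∃ b : TopologicalSpace.Compacts X → F.obj X n,
    (∀ K : TopologicalSpace.Compacts X, (F.sub X (K : Set X)ᶜ n).mkQ (b K) = c.1 K) ∧
    CauchySeq b ∧ Filter.Tendsto (fun K => ‖b K‖ₑ) Filter.atTop (𝓝 L)}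

variable {X}

/-- The image of a singular simplex, as a compact set. -/
def simplexImage {n : ℕ} (σ : SingSimplex X n) : TopologicalSpace.Compacts X :=
  ⟨Set.range σ, isCompact_range σ.continuous⟩

/-- The coefficient of `σ` in a finite chain. -/
def coeff {n : ℕ} (σ : SingSimplex X n) : singularNormed.obj X n →ₗ[ℝ] ℝ :=
  (Finsupp.lapply σ : (SingSimplex X n →₀ ℝ) →ₗ[ℝ] ℝ)

theorem coeff_eq_zero_of_mem_sub {n : ℕ} (σ : SingSimplex X n) :
    singularNormed.sub X (simplexImage σ : Set X)ᶜ n ≤ LinearMap.ker (coeff σ) := by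
  rintro _ ⟨b, rfl⟩
  refine Finsupp.mapDomain_of_notMem_range (f := fun τ => (incl (simplexImage σ : Set X)ᶜ).comp τ) b σ ?_
  rintro ⟨τ, hτ⟩
  obtain ⟨x⟩ : Nonempty (Simp n) := inferInstance
  have h : ((τ x : X)) = σ x := DFunLike.congr_fun hτ x
  exact (τ x).2 (h ▸ Set.mem_range_self x)

/-- The coefficient of `σ` in a locally finite real singular chain `c = (c_K)_K`, that is, the
coefficient of `σ` in any representative of `c_K`, where `K` is the image of `σ`. -/
def lfCoeff {n : ℕ} (σ : SingSimplex X n) : singularNormed.LF X n →ₗ[ℝ] ℝ :=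
  (Submodule.liftQ _ (coeff σ) (coeff_eq_zero_of_mem_sub σ)).comp
    ((LinearMap.proj (simplexImage σ)).comp (singularNormed.LF X n).subtype)

variable (X)

/-- The `ℓ¹`-norm of a locally finite real singular chain: the sum of the absolute values of
all its coefficients. -/
def lfL1Norm (n : ℕ) (c : singularNormed.LF X n) : ℝ≥0∞ :=
  ∑' σ : SingSimplex X n, ‖lfCoeff σ c‖ₑ

end LocallyFinite

/-- The operator norm of a linear map with respect to possibly infinite semi-norms `p` and `q`. -/
def opENorm {V : Type w} {W : Type w'} [AddCommGroup V] [Module ℝ V] [AddCommGroup W] [Module ℝ W]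
    (p : V → ℝ≥0∞) (q : W → ℝ≥0∞) (f : V →ₗ[ℝ] W) : ℝ≥0∞ :=
  sInf {C | ∀ c, q (f c) ≤ C * p c}

/-! ## Manifolds, orientations and fundamental classes -/

/-- The half-space `{v ∈ ℝⁿ | v₀ ≥ 0}`; for `n = 0` this is `ℝ⁰`. -/
abbrev HalfSpace (n : ℕ) : Type :=
  {v : EuclideanSpace ℝ (Fin n) // ∀ i : Fin n, (i : ℕ) = 0 → 0 ≤ v i}

/-- Topological `n`-manifolds with (possibly empty) boundary. -/
structure IsTopManifold (n : ℕ) (M : Type u) [TopologicalSpace M] : Prop where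
  t2 : T2Space M
  secondCountable : SecondCountableTopology M
  chart : ∀ x : M, ∃ e : OpenPartialHomeomorph M (HalfSpace n), x ∈ e.source

/-- The interior of an `n`-manifold: the points with an open neighbourhood that is homeomorphic to
an open subset of `ℝⁿ`. -/
def mInterior (n : ℕ) (M : Type u) [TopologicalSpace M] : Set M :=
  {x | ∃ e : OpenPartialHomeomorph M (EuclideanSpace ℝ (Fin n)), x ∈ e.source}

/-- The boundary of an `n`-manifold. -/
def mBoundary (n : ℕ) (M : Type u) [TopologicalSpace M] : Set M := (mInterior n M)ᶜ

/-- An orientation of an `n`-manifold `M`: a locally consistent choice of generators of the local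
homology groups `H_n(M, M \ {x}; ℤ)`, where `x` ranges over the interior of `M`. -/
structure MOrientation (n : ℕ) (M : Type u) [TopologicalSpace M] where
  loc : ∀ x : mInterior n M, ((singular ℤ).relCplx {(x : M)}ᶜ).Homology n
  generator : ∀ (x : mInterior n M) (β : ((singular ℤ).relCplx {(x : M)}ᶜ).Homology n),
    ∃ k : ℤ, β = k • loc x
  consistent : ∀ x : mInterior n M, ∃ U : Set M, IsOpen U ∧ (x : M) ∈ U ∧ U ⊆ mInterior n M ∧
    ∃ β : ((singular ℤ).relCplx Uᶜ).Homology n, ∀ (y : mInterior n M) (hy : (y : M) ∈ U),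
      ((singular ℤ).relInclHom
        (Set.compl_subset_compl.mpr (Set.singleton_subset_iff.mpr hy))).mapHomology n β = loc y

/-- The change of coefficients `C_n(X; ℤ) → C_n(X; ℝ)`. -/
def coeffMap (X : Type u) [TopologicalSpace X] (n : ℕ) :
    (singular ℤ).obj X n →ₛₗ[Int.castRingHom ℝ] singularNormed.obj X n :=
  Finsupp.mapRange.linearMap (α := SingSimplex X n) (Int.castRingHom ℝ).toSemilinearMap

theorem coeffMap_map {X Y : Type u} [TopologicalSpace X] [TopologicalSpace Y] (f : C(X, Y)) (n : ℕ)
    (c : (singular ℤ).obj X n) :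
    coeffMap Y n ((singular ℤ).map f n c) = singularNormed.map f n (coeffMap X n c) :=
  (Finsupp.mapDomain_mapRange (fun σ : SingSimplex X n => f.comp σ) c (Int.castRingHom ℝ)
    (map_zero _) (map_add _)).symm

theorem coeffMap_d (X : Type u) [TopologicalSpace X] (n : ℕ) (c : (singular ℤ).obj X (n + 1)) :
    singularNormed.d X n (coeffMap X (n + 1) c) = coeffMap X n ((singular ℤ).d X n c) := by
  change singD ℝ X n (Finsupp.mapRange.linearMap (Int.castRingHom ℝ).toSemilinearMap c) =
    Finsupp.mapRange.linearMap (Int.castRingHom ℝ).toSemilinearMap (singD ℤ X n c)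
  change SingSimplex X (n + 1) →₀ ℤ at c
  induction c using Finsupp.induction_linear with
  | zero => simp
  | add c c' hc hc' => simp only [map_add, hc, hc']
  | single σ r =>
    rw [singD_single, map_sum, Finsupp.mapRange.linearMap_apply, Finsupp.mapRange_single,
      singD_single]
    refine Finset.sum_congr rfl fun i _ => ?_
    rw [map_zsmul, Finsupp.mapRange.linearMap_apply, Finsupp.mapRange_single]

/-- The change of coefficients `C_*(X, A; ℤ) → C_*(X, A; ℝ)`. -/
def coeffHom {X : Type u} [TopologicalSpace X] (A : Set X) :
    Cplx.Hom (Int.castRingHom ℝ) ((singular ℤ).relCplx A) (singularNormed.relCplx A) where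
  f n := Submodule.mapQ _ _ (coeffMap X n) (by
    rintro _ ⟨b, rfl⟩
    exact ⟨coeffMap A n b, (coeffMap_map (incl A) n b).symm⟩)
  comm n c := by
    obtain ⟨b, rfl⟩ := Submodule.Quotient.mk_surjective _ c
    exact congrArg (singularNormed.sub X A n).mkQ (coeffMap_d X n b)

namespace MOrientation

variable {n : ℕ} {M : Type u} [TopologicalSpace M] (o : MOrientation n M)

theorem boundary_subset (x : mInterior n M) : mBoundary n M ⊆ {(x : M)}ᶜ := by
  intro y hy h
  rw [Set.mem_singleton_iff.mp h] at hy
  exact hy x.2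

/-- `α` is the real fundamental class `[M, ∂M] ∈ H_n(M, ∂M; ℝ)` of the oriented compact manifold
`M`: it restricts to the orientation in `H_n(M, M \ {x}; ℝ)` for every interior point `x`. -/
def IsRelFundamentalClass (α : (singularNormed.relCplx (mBoundary n M)).Homology n) : Prop :=
  ∀ x : mInterior n M, (singularNormed.relInclHom (boundary_subset x)).mapHomology n α =
    (coeffHom {(x : M)}ᶜ).mapHomology n (o.loc x)

/-- `α` is the locally finite real fundamental class of the oriented manifold `M` without boundary:
it restricts to the orientation in `H_n(M, M \ {x}; ℝ)` for every (interior) point `x`. -/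
def IsLfFundamentalClass (α : (singularNormed.lfCplx M).Homology n) : Prop :=
  ∀ x : mInterior n M, (singularNormed.lfProj ({(x : M)} : TopologicalSpace.Compacts M)).mapHomology n α =
    (coeffHom {(x : M)}ᶜ).mapHomology n (o.loc x)

/-- The simplicial volume `‖M, ∂M‖`. Since the fundamental class is unique, the outer infimum is
over a single class. -/
def simplicialVolume : ℝ≥0∞ :=
  ⨅ (α) (_ : o.IsRelFundamentalClass α),
    (singularNormed.relCplx (mBoundary n M)).homologyNorm n
      (fun c : singularNormed.Rel M (mBoundary n M) n => ‖c‖ₑ) α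

/-- The locally finite simplicial volume of `M`. -/
def lfSimplicialVolume : ℝ≥0∞ :=
  ⨅ (α) (_ : o.IsLfFundamentalClass α),
    (singularNormed.lfCplx M).homologyNorm n (lfL1Norm M n) α

/-- The `F`-simplicial volume `‖M, ∂M‖^F`, for a normed model `(F, φ, ψ)`: the infimum of the norms
of all relative cycles in `F_n(M, ∂M)` that represent `H_n(ψ)([M, ∂M])`. -/
def modelVolume (𝓜 : NormedModel.{u, v}) : ℝ≥0∞ :=
  ⨅ (α) (_ : o.IsRelFundamentalClass α),
    (𝓜.F.relCplx (mBoundary n M)).homologyNorm n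
      (fun c : 𝓜.F.Rel M (mBoundary n M) n => ‖c‖ₑ)
      ((𝓜.ψ.relHom (mBoundary n M)).mapHomology n α)

/-- The locally finite `F`-simplicial volume of `M`: the infimum of the norms of all cycles in
`F^lf_n(M)` that represent the image of the locally finite fundamental class under `ψ`. -/
def lfModelVolume (𝓜 : NormedModel.{u, v}) : ℝ≥0∞ :=
  ⨅ (α) (_ : o.IsLfFundamentalClass α),
    (𝓜.F.lfCplx M).homologyNorm n (lfNorm M 𝓜.F n) ((𝓜.ψ.lfHom M).mapHomology n α)

end MOrientation

end NormedModels

end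

/-!
The chain maps `φ` and `ψ` and the homotopies between their composites and the identities are
natural, so they pass to pairs and to locally finite chains. In particular `H_n(φ) ∘ H_n(ψ) = id` on
relative and on locally finite singular homology: `ψ` maps cycles that represent a class `α` to
cycles that represent `H_n(ψ)(α)`, and `φ` maps cycles that represent `H_n(ψ)(α)` to cycles that
represent `α`. Each of the four inequalities follows from a bound of the norm of `ψ` or `φ` on
chains.

* `ψ(σ) = F(σ)(ψ(id))` for a singular simplex `σ`, and `F(σ)` does not increase norms; hence the norm
  of `ψ_n` on every space, and on every pair, is at most its norm `C` on the standard simplex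
  (`norm_app_le`, `enorm_relApp_le`).
* A locally finite chain `c` of finite `ℓ¹`-norm is the limit of the finite chains `s_K` of all its
  terms that meet a compact set `K`. The family `(s_K)_K` is Cauchy (`cauchySeq_lfTrunc`), so `ψ(s_K)`
  is a Cauchy family that represents `ψ^lf(c)`, of norm at most `C · |c|₁` (`lfNorm_lfApp_le`).
* If `(b_K)_K` represents `c`, then each finite set of coefficients of `φ^lf(c)` agrees with the
  coefficients of `φ(b_K)` for all large `K`. So `φ^lf` is bounded (`lfL1Norm_lfApp_le`).

All volumes are infima over classes that restrict to the orientation; by comparing them class by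
class, neither existence nor uniqueness of fundamental classes is needed, except that `C * ∞` is `0`
for `C = 0`. But if one of the constants is zero, then `id = H_n(φ) ∘ H_n(ψ)` vanishes on
`H_n(M, M \ {x}; ℝ)` for all interior points `x`, so the zero class is a fundamental class and the
volume on the left-hand side is zero.
-/

noncomputable section

namespace NormedModels

/-! ### Chain homotopies and homology norms -/

namespace Cplx

variable {R : Type} [Ring R] {K : Cplx.{w} R} {L : Cplx.{w'} R}

theorem classOf_eq_iff {n : ℕ} {c c' : K.cycles n} :
    K.classOf n c = K.classOf n c' ↔ (c : K.V n) - c' ∈ K.boundaries n :=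
  Submodule.Quotient.eq _

theorem classOf_surjective (n : ℕ) (α : K.Homology n) : ∃ c, K.classOf n c = α :=
  Submodule.mkQ_surjective _ α

theorem Hom.mapHomology_classOf (g : Hom (RingHom.id R) K L) (n : ℕ) (c : K.cycles n) :
    g.mapHomology n (K.classOf n c) = L.classOf n (g.mapCycles n c) :=
  rfl

/-- A chain map `g` that is a left inverse of `f` up to chain homotopy induces a left inverse of
`f` on homology. -/
theorem Hom.mapHomology_mapHomology_of_homotopy (f : Hom (RingHom.id R) K L)
    (g : Hom (RingHom.id R) L K) (h : ∀ n, K.V n →ₗ[R] K.V (n + 1))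
    (h_zero : ∀ c, K.d 0 (h 0 c) = g.f 0 (f.f 0 c) - c)
    (h_succ : ∀ n c, K.d (n + 1) (h (n + 1) c) + h n (K.d n c) =
      g.f (n + 1) (f.f (n + 1) c) - c)
    (n : ℕ) (α : K.Homology n) : g.mapHomology n (f.mapHomology n α) = α := by
  obtain ⟨c, rfl⟩ := classOf_surjective n α
  rw [mapHomology_classOf, mapHomology_classOf, classOf_eq_iff]
  refine ⟨h n c, ?_⟩
  cases n with
  | zero => exact h_zero c
  | succ n =>
    have hc : K.d n c = 0 := c.2
    have := h_succ n c
    rw [hc, map_zero, add_zero] at this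
    exact this

theorem classOf_zero (n : ℕ) : K.classOf n 0 = 0 :=
  LinearMap.map_zero _

theorem Hom.mapHomology_eq_zero (g : Hom (RingHom.id R) K L) (n : ℕ) (hg : ∀ c, g.f n c = 0)
    (α : K.Homology n) : g.mapHomology n α = 0 := by
  obtain ⟨c, rfl⟩ := classOf_surjective n α
  rw [mapHomology_classOf, show g.mapCycles n c = 0 from Subtype.ext (hg c)]
  exact L.classOf_zero n

theorem homologyNorm_zero (n : ℕ) (p : K.V n → ℝ≥0∞) (hp : p 0 = 0) :
    K.homologyNorm n p 0 = 0 :=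
  le_antisymm ((iInf₂_le (0 : K.cycles n) (K.classOf_zero n)).trans hp.le) zero_le

end Cplx

/-- Comparison of two infima over the same index set up to a factor `C`. If `C = 0`, then `C * ∞`
is `0`, so the left-hand side has to be shown to vanish. -/
theorem biInf_le_mul_biInf {ι : Type w} {P : ι → Prop} {a b : ι → ℝ≥0∞} {C : ℝ≥0∞} (hC : C ≠ ∞)
    (h₀ : C = 0 → ∃ i, P i ∧ a i = 0) (h : C ≠ 0 → ∀ i, P i → a i ≤ C * b i) :
    ⨅ (i) (_ : P i), a i ≤ C * ⨅ (i) (_ : P i), b i := by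
  by_cases hC₀ : C = 0
  · obtain ⟨i, hi, hai⟩ := h₀ hC₀
    exact ((iInf₂_le i hi).trans hai.le).trans zero_le
  · simp only [ENNReal.mul_iInf_of_ne hC₀ hC]
    exact le_iInf₂ fun i hi => (iInf₂_le i hi).trans (h hC₀ i hi)

namespace Cplx

variable {R : Type} [Ring R] {K : Cplx.{w} R} {L : Cplx.{w'} R}

theorem Hom.homologyNorm_le (g : Hom (RingHom.id R) K L) (n : ℕ) {p : K.V n → ℝ≥0∞}
    {q : L.V n → ℝ≥0∞} {C : ℝ≥0∞} (hC₀ : C ≠ 0) (hC : C ≠ ∞) (h : ∀ c, q (g.f n c) ≤ C * p c)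
    {α : K.Homology n} {β : L.Homology n} (hβ : g.mapHomology n α = β) :
    L.homologyNorm n q β ≤ C * K.homologyNorm n p α := by
  simp only [homologyNorm, ENNReal.mul_iInf_of_ne hC₀ hC]
  exact le_iInf₂ fun c hc => (iInf₂_le (g.mapCycles n c) (by
    rw [← mapHomology_classOf, hc, hβ])).trans (h c)

end Cplx

/-! ### Normed models on pairs and on locally finite chains -/

namespace NatNormedHomotopy

variable {F : FunctorialNormedCplx.{u, v}} {G : FunctorialNormedCplx.{u, v'}}
  {η θ : NatContChainMap F G} (H : NatNormedHomotopy η θ) {X : Type u} [TopologicalSpace X]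

/-- The map `F_n(X, A) → G_{n+1}(X, A)` induced by a natural homotopy. -/
def rel (A : Set X) (n : ℕ) : F.Rel X A n →ₗ[ℝ] G.Rel X A (n + 1) :=
  Submodule.mapQ _ _ (H.h X n).toLinearMap (by
    rintro _ ⟨b, rfl⟩
    exact ⟨H.h A n b, (H.naturality (incl A) n b).symm⟩)

theorem relIncl_rel {A B : Set X} (h : A ⊆ B) (n : ℕ) (c : F.Rel X A n) :
    G.relIncl h (n + 1) (H.rel A n c) = H.rel B n (F.relIncl h n c) := by
  obtain ⟨b, rfl⟩ := Submodule.Quotient.mk_surjective _ c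
  rfl

theorem rel_zero (A : Set X) (c : F.Rel X A 0) :
    G.relD A 0 (H.rel A 0 c) = η.relApp A 0 c - θ.relApp A 0 c := by
  obtain ⟨b, rfl⟩ := Submodule.Quotient.mk_surjective _ c
  exact congrArg (G.sub X A 0).mkQ (H.homotopy_zero X b)

theorem rel_succ (A : Set X) (n : ℕ) (c : F.Rel X A (n + 1)) :
    G.relD A (n + 1) (H.rel A (n + 1) c) + H.rel A n (F.relD A n c) =
      η.relApp A (n + 1) c - θ.relApp A (n + 1) c := by
  obtain ⟨b, rfl⟩ := Submodule.Quotient.mk_surjective _ c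
  exact congrArg (G.sub X A (n + 1)).mkQ (H.homotopy_succ X n b)

variable (X) in
/-- The map `F^lf_n(X) → G^lf_{n+1}(X)` induced by a natural homotopy. -/
def lf (n : ℕ) : F.LF X n →ₗ[ℝ] G.LF X (n + 1) where
  toFun c := ⟨fun K => H.rel (K : Set X)ᶜ n (c.1 K), fun K L h =>
    (H.relIncl_rel _ n (c.1 L)).trans (congrArg (H.rel (K : Set X)ᶜ n) (c.2 K L h))⟩
  map_add' c c' := Subtype.ext (funext fun K => map_add _ (c.1 K) (c'.1 K))
  map_smul' r c := Subtype.ext (funext fun K => map_smul _ r (c.1 K))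

end NatNormedHomotopy

section Comp

variable {F : FunctorialNormedCplx.{u, v}} {G : FunctorialNormedCplx.{u, v'}}
  {η : NatContChainMap F G} {θ : NatContChainMap G F} {X : Type u} [TopologicalSpace X]

theorem NatContChainMap.relApp_comp {E : FunctorialNormedCplx.{u, w}} (θ : NatContChainMap G E)
    (η : NatContChainMap F G) (A : Set X) (n : ℕ) (c : F.Rel X A n) :
    (θ.comp η).relApp A n c = θ.relApp A n (η.relApp A n c) := by
  obtain ⟨b, rfl⟩ := Submodule.Quotient.mk_surjective _ c
  rfl

theorem NatContChainMap.relApp_id (A : Set X) (n : ℕ) (c : F.Rel X A n) :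
    (NatContChainMap.id F).relApp A n c = c := by
  obtain ⟨b, rfl⟩ := Submodule.Quotient.mk_surjective _ c
  rfl

theorem NatNormedHomotopy.mapHomology_relHom
    (H : NatNormedHomotopy (θ.comp η) (NatContChainMap.id F)) (A : Set X) (n : ℕ)
    (α : (F.relCplx A).Homology n) :
    (θ.relHom A).mapHomology n ((η.relHom A).mapHomology n α) = α :=
  (η.relHom A).mapHomology_mapHomology_of_homotopy (θ.relHom A) (H.rel A)
    (fun c => by
      refine (H.rel_zero A c).trans ?_
      exact congrArg₂ (· - ·) (NatContChainMap.relApp_comp θ η A 0 c)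
        (NatContChainMap.relApp_id A 0 c))
    (fun n c => by
      refine (H.rel_succ A n c).trans ?_
      exact congrArg₂ (· - ·) (NatContChainMap.relApp_comp θ η A _ c)
        (NatContChainMap.relApp_id A _ c)) n α

theorem NatNormedHomotopy.mapHomology_lfHom
    (H : NatNormedHomotopy (θ.comp η) (NatContChainMap.id F)) (n : ℕ)
    (α : (F.lfCplx X).Homology n) :
    (θ.lfHom X).mapHomology n ((η.lfHom X).mapHomology n α) = α :=
  (η.lfHom X).mapHomology_mapHomology_of_homotopy (θ.lfHom X) (H.lf X)
    (fun c => by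
      refine Subtype.ext (funext fun K => (H.rel_zero _ (c.1 K)).trans ?_)
      rw [NatContChainMap.relApp_comp, NatContChainMap.relApp_id]; rfl)
    (fun n c => by
      refine Subtype.ext (funext fun K => (H.rel_succ _ n (c.1 K)).trans ?_)
      rw [NatContChainMap.relApp_comp, NatContChainMap.relApp_id]; rfl) n α

end Comp

/-! ### Norm bounds for finite and relative chains -/

section Norms

variable {F : FunctorialNormedCplx.{u, v}}

/-- The singular simplex `σ`, as a chain. -/
def simplexChain {X : Type u} [TopologicalSpace X] {n : ℕ} (σ : SingSimplex X n) :
    singularNormed.{u}.obj X n :=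
  (Finsupp.single σ 1 : SingSimplex X n →₀ ℝ)

theorem norm_simplexChain {X : Type u} [TopologicalSpace X] {n : ℕ} (σ : SingSimplex X n) :
    ‖simplexChain σ‖ = 1 :=
  (l1_single σ 1).trans abs_one

theorem eq_sum_simplexChain {X : Type u} [TopologicalSpace X] {n : ℕ}
    (c : singularNormed.{u}.obj X n) :
    c = ∑ σ ∈ Finsupp.support (show SingSimplex X n →₀ ℝ from c), coeff σ c • simplexChain σ := by
  refine (Finsupp.sum_single (show SingSimplex X n →₀ ℝ from c)).symm.trans ?_
  refine Finset.sum_congr rfl fun σ _ => ?_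
  refine Eq.trans ?_ (Finsupp.smul_single (coeff σ c) σ (1 : ℝ)).symm
  rw [smul_eq_mul, mul_one]
  rfl

theorem map_simplexChain {X Y : Type u} [TopologicalSpace X] [TopologicalSpace Y] {n : ℕ}
    (f : C(X, Y)) (σ : SingSimplex X n) :
    singularNormed.map f n (simplexChain σ) = simplexChain (f.comp σ) :=
  Finsupp.mapDomain_single

/-- The identity of the standard simplex, as a singular simplex of `ULift Δⁿ`. -/
def universalSimplex (n : ℕ) : SingSimplex (ULift.{u} (Simp n)) n :=
  ⟨ULift.up, continuous_uliftUp⟩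

variable {X : Type u} [TopologicalSpace X]

/-- By naturality, `ψ(σ)` is the image under `F(σ)` of `ψ` of the universal simplex, and `F(σ)` does
not increase norms. -/
theorem norm_app_simplexChain_le (ψ : NatContChainMap singularNormed.{u} F) {n : ℕ}
    (σ : SingSimplex X n) :
    ‖ψ.app X n (simplexChain σ)‖ ≤ ‖ψ.app (ULift.{u} (Simp n)) n‖ := by
  let f : C(ULift.{u} (Simp n), X) := σ.comp ⟨ULift.down, continuous_uliftDown⟩
  have hf : simplexChain σ = singularNormed.map f n (simplexChain (universalSimplex n)) :=
    (map_simplexChain f (universalSimplex n)).symm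
  rw [hf, ψ.naturality]
  refine (F.norm_map_le f n _).trans ?_
  refine ((ψ.app _ n).le_opNorm _).trans ?_
  rw [norm_simplexChain, mul_one]

theorem norm_app_le (ψ : NatContChainMap singularNormed.{u} F) {n : ℕ}
    (c : singularNormed.{u}.obj X n) :
    ‖ψ.app X n c‖ ≤ ‖ψ.app (ULift.{u} (Simp n)) n‖ * ‖c‖ := by
  have hc : ‖c‖ = ∑ σ ∈ Finsupp.support (show SingSimplex X n →₀ ℝ from c), |coeff σ c| := rfl
  rw [hc, Finset.mul_sum]
  conv_lhs => rw [eq_sum_simplexChain c, map_sum]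
  refine norm_sum_le_of_le _ fun σ _ => ?_
  rw [map_smul, norm_smul, mul_comm, Real.norm_eq_abs]
  gcongr
  exact norm_app_simplexChain_le ψ σ

theorem enorm_relApp_le (ψ : NatContChainMap singularNormed.{u} F) {n : ℕ} (A : Set X)
    (c : singularNormed.{u}.Rel X A n) :
    ‖ψ.relApp A n c‖ₑ ≤ ‖ψ.app (ULift.{u} (Simp n)) n‖ₑ * ‖c‖ₑ := by
  suffices h : ‖ψ.relApp A n c‖ ≤ ‖ψ.app (ULift.{u} (Simp n)) n‖ * ‖c‖ by
    rw [← ofReal_norm, ← ofReal_norm, ← ofReal_norm, ← ENNReal.ofReal_mul (norm_nonneg _)]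
    exact ENNReal.ofReal_le_ofReal h
  refine le_of_forall_pos_le_add fun ε hε => ?_
  set C := ‖ψ.app (ULift.{u} (Simp n)) n‖
  have hC : 0 ≤ C := norm_nonneg _
  obtain ⟨b, rfl, hb⟩ := Submodule.Quotient.norm_mk_lt (S := singularNormed.sub X A n) c
    (show 0 < ε / (C + 1) by positivity)
  calc ‖(F.sub X A n).mkQ (ψ.app X n b)‖ ≤ ‖ψ.app X n b‖ := Submodule.Quotient.norm_mk_le _ _
    _ ≤ C * ‖b‖ := norm_app_le ψ b
    _ ≤ C * (‖(Submodule.Quotient.mk b : singularNormed.Rel X A n)‖ + ε / (C + 1)) := by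
      gcongr
    _ ≤ _ := by
      rw [mul_add, mul_div_assoc']
      gcongr
      rw [div_le_iff₀ (by positivity)]
      nlinarith

end Norms

/-! ### Norm bounds for locally finite chains -/

section LocallyFiniteNorms

variable {X : Type u} [TopologicalSpace X] {n : ℕ}

theorem sum_enorm_coeff_le (S : Finset (SingSimplex X n)) (c : singularNormed.{u}.obj X n) :
    ∑ σ ∈ S, ‖coeff σ c‖ₑ ≤ ‖c‖ₑ := by
  classical
  have hc : ‖c‖ = ∑ σ ∈ S ∪ Finsupp.support (show SingSimplex X n →₀ ℝ from c), |coeff σ c| :=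
    l1_eq_sum _ Finset.subset_union_right
  have : ∑ σ ∈ S, ‖coeff σ c‖ ≤ ‖c‖ := by
    rw [hc]
    exact Finset.sum_le_sum_of_subset_of_nonneg Finset.subset_union_left
      fun _ _ _ => abs_nonneg _
  simp_rw [← ofReal_norm]
  rw [← ENNReal.ofReal_sum_of_nonneg fun _ _ => norm_nonneg _]
  exact ENNReal.ofReal_le_ofReal this

/-- A finite chain lies in the image of `C_n(A)` if and only if it involves no simplex that
leaves `A`. -/
theorem mem_sub_iff_coeff_eq_zero (A : Set X) (c : singularNormed.{u}.obj X n) :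
    c ∈ singularNormed.sub X A n ↔ ∀ σ : SingSimplex X n, ¬ Set.range σ ⊆ A → coeff σ c = 0 := by
  constructor
  · rintro ⟨b, rfl⟩ σ hσ
    refine Finsupp.mapDomain_of_notMem_range (f := fun τ => (incl A).comp τ) b σ ?_
    rintro ⟨τ, rfl⟩
    exact hσ (Set.range_subset_iff.2 fun x => (τ x).2)
  · intro h
    rw [eq_sum_simplexChain c]
    refine Submodule.sum_mem _ fun σ hσ => Submodule.smul_mem _ _ ?_
    have hA : Set.range σ ⊆ A := by
      by_contra hA
      exact Finsupp.mem_support_iff.1 hσ (h σ hA)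
    let τ : SingSimplex A n := ⟨fun x => ⟨σ x, hA ⟨x, rfl⟩⟩, by fun_prop⟩
    exact ⟨simplexChain τ, map_simplexChain (incl A) τ⟩

/-- The coefficients of `c = (c_K)_K` can be read off from `c_K` for all simplices that meet `K`,
not only for those that are contained in `K`. -/
theorem coeff_eq_lfCoeff (c : singularNormed.{u}.LF X n) (K : TopologicalSpace.Compacts X)
    (σ : SingSimplex X n) (hσ : ¬ Set.range σ ⊆ (K : Set X)ᶜ) (b : singularNormed.{u}.obj X n)
    (hb : (singularNormed.sub X (K : Set X)ᶜ n).mkQ b = c.1 K) : coeff σ b = lfCoeff σ c := by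
  have hK : (K : Set X) ⊆ (K ⊔ simplexImage σ : TopologicalSpace.Compacts X) :=
    Set.subset_union_left
  have hI : (simplexImage σ : Set X) ⊆ (K ⊔ simplexImage σ : TopologicalSpace.Compacts X) :=
    Set.subset_union_right
  obtain ⟨b', hb'⟩ := Submodule.mkQ_surjective _ (c.1 (K ⊔ simplexImage σ))
  have h₁ := c.2 _ _ hK
  have h₂ := c.2 _ _ hI
  rw [← hb'] at h₁ h₂
  have h₃ : lfCoeff σ c = coeff σ b' := by
    change Submodule.liftQ _ (coeff σ) (coeff_eq_zero_of_mem_sub σ) (c.1 (simplexImage σ)) = _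
    rw [← h₂]
    rfl
  rw [h₃, ← sub_eq_zero, ← map_sub]
  refine (mem_sub_iff_coeff_eq_zero _ _).1 ?_ σ hσ
  exact (Submodule.Quotient.eq _).1 (hb.trans h₁.symm)

open Classical in
/-- The finite part of the locally finite chain `c` that consists of all simplices that meet the
compact set `K`. -/
def lfTrunc (c : singularNormed.{u}.LF X n) (K : TopologicalSpace.Compacts X) :
    singularNormed.{u}.obj X n :=
  Finsupp.filter (fun σ : SingSimplex X n => ¬ Set.range σ ⊆ (K : Set X)ᶜ)
    (show SingSimplex X n →₀ ℝ from (Submodule.mkQ_surjective _ (c.1 K)).choose)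

open Classical in
theorem coeff_lfTrunc (c : singularNormed.{u}.LF X n) (K : TopologicalSpace.Compacts X)
    (σ : SingSimplex X n) :
    coeff σ (lfTrunc c K) = if Set.range σ ⊆ (K : Set X)ᶜ then 0 else lfCoeff σ c := by
  refine (Finsupp.filter_apply
    (fun σ : SingSimplex X n => ¬ Set.range σ ⊆ (K : Set X)ᶜ) _ σ).trans ?_
  rw [ite_not]
  split_ifs with h
  · rfl
  · exact coeff_eq_lfCoeff c K σ h _ (Submodule.mkQ_surjective _ (c.1 K)).choose_spec

theorem mkQ_lfTrunc (c : singularNormed.{u}.LF X n) (K : TopologicalSpace.Compacts X) :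
    (singularNormed.sub X (K : Set X)ᶜ n).mkQ (lfTrunc c K) = c.1 K := by
  obtain ⟨b, hb⟩ := Submodule.mkQ_surjective _ (c.1 K)
  rw [← hb]
  refine (Submodule.Quotient.eq _).2 ((mem_sub_iff_coeff_eq_zero _ _).2 fun σ hσ => ?_)
  rw [map_sub, coeff_lfTrunc, if_neg hσ, coeff_eq_lfCoeff c K σ hσ b hb, sub_self]

theorem enorm_lfTrunc_le (c : singularNormed.{u}.LF X n) (K : TopologicalSpace.Compacts X) :
    ‖lfTrunc c K‖ₑ ≤ lfL1Norm X n c := by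
  have h : ‖lfTrunc c K‖ = ∑ σ ∈ Finsupp.support (show SingSimplex X n →₀ ℝ from lfTrunc c K),
    ‖coeff σ (lfTrunc c K)‖ := rfl
  rw [← ofReal_norm, h, ENNReal.ofReal_sum_of_nonneg fun _ _ => norm_nonneg _]
  refine (Finset.sum_le_sum fun σ _ => ?_).trans (ENNReal.sum_le_tsum _)
  rw [ofReal_norm, coeff_lfTrunc]
  split_ifs <;> simp

theorem not_range_subset_compl {σ : SingSimplex X n} {K : TopologicalSpace.Compacts X}
    (h : simplexImage σ ≤ K) : ¬ Set.range σ ⊆ (K : Set X)ᶜ := fun hσ => by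
  obtain ⟨x⟩ : Nonempty (Simp n) := inferInstance
  exact hσ ⟨x, rfl⟩ (h ⟨x, rfl⟩)

/-- If `c` has finite `ℓ¹`-norm, then the difference of two truncations of `c` at large compact sets
only involves simplices outside a given finite set, and so has small norm. -/
theorem cauchySeq_lfTrunc (c : singularNormed.{u}.LF X n) (hc : lfL1Norm X n c ≠ ∞) :
    CauchySeq (lfTrunc c) := by
  have hs : Summable fun σ : SingSimplex X n => ‖lfCoeff σ c‖ := by
    have h : ∑' σ : SingSimplex X n, (‖lfCoeff σ c‖₊ : ℝ≥0∞) ≠ ∞ := hc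
    exact NNReal.summable_coe.2 (ENNReal.tsum_coe_ne_top_iff_summable.1 h)
  refine Metric.cauchySeq_iff'.2 fun ε hε => ?_
  obtain ⟨S, hS⟩ := summable_iff_vanishing_norm.1 hs ε hε
  refine ⟨S.sup simplexImage, fun K hK => ?_⟩
  set N := S.sup (simplexImage (X := X) (n := n))
  rw [dist_eq_norm]
  set D := lfTrunc c K - lfTrunc c N with hD
  set T := Finsupp.support (show SingSimplex X n →₀ ℝ from D)
  have hDT : ‖D‖ = ∑ σ ∈ T, ‖coeff σ D‖ := rfl
  have hT : Disjoint T S := by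
    refine Finset.disjoint_left.2 fun σ hσ hσS => ?_
    have hN : simplexImage σ ≤ N := Finset.le_sup hσS
    refine Finsupp.mem_support_iff.1 hσ ?_
    change coeff σ D = 0
    rw [hD, map_sub, coeff_lfTrunc, coeff_lfTrunc, if_neg (not_range_subset_compl hN),
      if_neg (not_range_subset_compl (hN.trans hK)), sub_self]
  refine lt_of_le_of_lt ?_ (hS T hT)
  rw [hDT, Real.norm_of_nonneg (Finset.sum_nonneg fun _ _ => norm_nonneg _)]
  refine Finset.sum_le_sum fun σ _ => ?_
  rw [hD, map_sub, coeff_lfTrunc, coeff_lfTrunc]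
  split_ifs <;> simp

variable {F : FunctorialNormedCplx.{u, v}}

theorem lfNorm_zero : lfNorm X F n 0 = 0 := by
  refine le_antisymm (sInf_le ⟨fun _ => 0, fun K => map_zero _, cauchySeq_const _, ?_⟩) zero_le
  simp

theorem lfL1Norm_zero : lfL1Norm X n 0 = 0 := by
  simp [lfL1Norm]

theorem lfNorm_lfApp_le (ψ : NatContChainMap singularNormed.{u} F)
    (hψ : ‖ψ.app (ULift.{u} (Simp n)) n‖ₑ ≠ 0) (c : singularNormed.{u}.LF X n) :
    lfNorm X F n (ψ.lfApp X n c) ≤ ‖ψ.app (ULift.{u} (Simp n)) n‖ₑ * lfL1Norm X n c := by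
  by_cases hc : lfL1Norm X n c = ∞
  · rw [hc, ENNReal.mul_top hψ]
    exact le_top
  have hb : CauchySeq fun K => ψ.app X n (lfTrunc c K) :=
    (ψ.app X n).uniformContinuous.comp_cauchySeq (cauchySeq_lfTrunc c hc)
  obtain ⟨L, hL⟩ := cauchySeq_tendsto_of_complete (uniformContinuous_norm.comp_cauchySeq hb)
  have hL' : Filter.Tendsto (fun K => ‖ψ.app X n (lfTrunc c K)‖ₑ) Filter.atTop
      (𝓝 (ENNReal.ofReal L)) := by
    simp_rw [← ofReal_norm]
    exact ENNReal.tendsto_ofReal hL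
  have hle : lfNorm X F n (ψ.lfApp X n c) ≤ ENNReal.ofReal L :=
    sInf_le ⟨_, fun K => congrArg (ψ.relApp (K : Set X)ᶜ n) (mkQ_lfTrunc c K), hb, hL'⟩
  refine hle.trans (le_of_tendsto' hL' fun K => ?_)
  · have h := norm_app_le ψ (lfTrunc c K)
    calc ‖ψ.app X n (lfTrunc c K)‖ₑ
        ≤ ‖ψ.app (ULift.{u} (Simp n)) n‖ₑ * ‖lfTrunc c K‖ₑ := by
          rw [← ofReal_norm, ← ofReal_norm, ← ofReal_norm, ← ENNReal.ofReal_mul (norm_nonneg _)]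
          exact ENNReal.ofReal_le_ofReal h
      _ ≤ _ := by
          gcongr
          exact enorm_lfTrunc_le c K

/-- A finite sum of absolute values of coefficients of `φ^lf(c)` is bounded by the norm of `φ(b_K)`,
for every family `(b_K)_K` that represents `c` and all sufficiently large `K`. -/
theorem lfL1Norm_lfApp_le (φ : NatContChainMap F singularNormed.{u}) (c : F.LF X n) :
    lfL1Norm X n (φ.lfApp X n c) ≤ (‖φ.app X n‖ₑ + 1) * lfNorm X F n c := by
  have hC₀ : ‖φ.app X n‖ₑ + 1 ≠ 0 := by simp
  have hC : ‖φ.app X n‖ₑ + 1 ≠ ∞ := by simp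
  rw [lfNorm, sInf_eq_iInf]
  simp only [ENNReal.mul_iInf_of_ne hC₀ hC]
  refine le_iInf₂ fun L ⟨b, hbc, _, hL⟩ => ?_
  rw [lfL1Norm, ENNReal.tsum_eq_iSup_sum]
  refine iSup_le fun S => ?_
  refine ge_of_tendsto (ENNReal.Tendsto.const_mul hL (Or.inr hC)) ?_
  filter_upwards [Filter.eventually_ge_atTop (S.sup simplexImage)] with K hK
  calc ∑ σ ∈ S, ‖lfCoeff σ (φ.lfApp X n c)‖ₑ = ∑ σ ∈ S, ‖coeff σ (φ.app X n (b K))‖ₑ := by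
        refine Finset.sum_congr rfl fun σ hσ => ?_
        rw [coeff_eq_lfCoeff (φ.lfApp X n c) K σ
          (not_range_subset_compl ((Finset.le_sup hσ).trans hK))]
        exact congrArg (φ.relApp (K : Set X)ᶜ n) (hbc K)
    _ ≤ ‖φ.app X n (b K)‖ₑ := sum_enorm_coeff_le S _
    _ ≤ ‖φ.app X n‖ₑ * ‖b K‖ₑ := (φ.app X n).le_opENorm _
    _ ≤ _ := by gcongr; exact le_self_add

/-- The locally finite chain `(b)_K` given by a chain `b` of `F_n(X)`. -/
def toLF (F : FunctorialNormedCplx.{u, v}) (b : F.obj X n) : F.LF X n :=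
  ⟨fun K => (F.sub X (K : Set X)ᶜ n).mkQ b, fun _ _ _ => rfl⟩

theorem lfNorm_toLF_le (b : F.obj X n) : lfNorm X F n (toLF F b) ≤ ‖b‖ₑ :=
  sInf_le ⟨fun _ => b, fun _ => rfl, cauchySeq_const _, tendsto_const_nhds⟩

end LocallyFiniteNorms

section OpENorm

variable {V : Type w} {W : Type w'} [AddCommGroup V] [Module ℝ V] [AddCommGroup W] [Module ℝ W]
  {p : V → ℝ≥0∞} {q : W → ℝ≥0∞} {f : V →ₗ[ℝ] W}

/-- The hypothesis `h` excludes the product `0 * ∞` on the right-hand side; `hf` excludes the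
product `∞ * 0`. -/
theorem le_opENorm (hf : opENorm p q f ≠ ∞) (c : V) (h : opENorm p q f ≠ 0 ∨ p c ≠ ∞) :
    q (f c) ≤ opENorm p q f * p c := by
  have hne : Nonempty {C | ∀ c, q (f c) ≤ C * p c} := by
    by_contra hne
    rw [Set.nonempty_coe_sort, Set.not_nonempty_iff_eq_empty] at hne
    exact hf (by rw [opENorm, hne, sInf_empty])
  rw [opENorm, sInf_eq_iInf'] at h ⊢
  rw [ENNReal.iInf_mul' (fun hp h₀ => (h.elim (· h₀) (· hp)).elim) fun _ => hne]
  exact le_iInf fun C => C.2 c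

end OpENorm

/-! ### Vanishing constants and fundamental classes -/

section Vanishing

theorem enorm_rel_zero {F : FunctorialNormedCplx.{u, v}} {X : Type u} [TopologicalSpace X] {n : ℕ}
    (A : Set X) : ‖(0 : F.Rel X A n)‖ₑ = 0 := by
  rw [← ofReal_norm, norm_zero, ENNReal.ofReal_zero]

/-- The quotient semi-norm on relative singular chains is a norm: all representatives have the same
coefficients at the simplices that leave `A`. -/
theorem rel_eq_zero_of_norm_eq_zero {X : Type u} [TopologicalSpace X] {n : ℕ} {A : Set X}
    {c : singularNormed.{u}.Rel X A n} (hc : ‖c‖ = 0) : c = 0 := by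
  obtain ⟨b, rfl⟩ := Submodule.Quotient.mk_surjective _ c
  refine (Submodule.Quotient.mk_eq_zero _).2 ((mem_sub_iff_coeff_eq_zero _ _).2 fun σ hσ => ?_)
  refine norm_le_zero_iff.1 (le_of_forall_pos_le_add fun ε hε => ?_)
  obtain ⟨b', hb', hε'⟩ := Submodule.Quotient.norm_mk_lt (S := singularNormed.sub X A n) _ hε
  rw [hc] at hε'
  have h := (mem_sub_iff_coeff_eq_zero A _).1 ((Submodule.Quotient.eq _).1 hb') σ hσ
  rw [map_sub, sub_eq_zero] at h
  rw [← h]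
  have h₁ := sum_enorm_coeff_le {σ} b'
  rw [Finset.sum_singleton, ← ofReal_norm, ← ofReal_norm,
    ENNReal.ofReal_le_ofReal_iff (norm_nonneg _)] at h₁
  exact h₁.trans hε'.le

variable {𝓜 : NormedModel.{u, v}} {X : Type u} [TopologicalSpace X] {n : ℕ}

theorem NormedModel.mapHomology_φ_ψ_rel (𝓜 : NormedModel.{u, v}) (A : Set X)
    (α : (singularNormed.{u}.relCplx A).Homology n) :
    (𝓜.φ.relHom A).mapHomology n ((𝓜.ψ.relHom A).mapHomology n α) = α :=
  𝓜.φ_ψ.some.mapHomology_relHom A n α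

theorem NormedModel.mapHomology_φ_ψ_lf (𝓜 : NormedModel.{u, v})
    (α : (singularNormed.{u}.lfCplx X).Homology n) :
    (𝓜.φ.lfHom X).mapHomology n ((𝓜.ψ.lfHom X).mapHomology n α) = α :=
  𝓜.φ_ψ.some.mapHomology_lfHom n α

/-- The identity of `H_n(X, A; ℝ)` factors through the map induced by `φ`. -/
theorem homology_eq_zero_of_φ_eq_zero {A : Set X} (h : ∀ c, 𝓜.φ.relApp A n c = 0)
    (α : (singularNormed.{u}.relCplx A).Homology n) : α = 0 := by
  rw [← 𝓜.mapHomology_φ_ψ_rel A α]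
  exact (𝓜.φ.relHom A).mapHomology_eq_zero n h _

theorem relApp_eq_zero_of_enorm_eq_zero (hψ : ‖𝓜.ψ.app (ULift.{u} (Simp n)) n‖ₑ = 0)
    (A : Set X) (c : singularNormed.{u}.Rel X A n) : 𝓜.ψ.relApp A n c = 0 := by
  obtain ⟨b, rfl⟩ := Submodule.Quotient.mk_surjective _ c
  have hb : 𝓜.ψ.app X n b = 0 := by
    have h := norm_app_le 𝓜.ψ b
    rw [← toReal_enorm (𝓜.ψ.app _ n), hψ, ENNReal.toReal_zero, zero_mul] at h
    exact norm_le_zero_iff.1 h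
  exact (congrArg (𝓜.F.sub X A n).mkQ hb).trans (map_zero _)

theorem homology_eq_zero_of_ψ_eq_zero (hψ : ‖𝓜.ψ.app (ULift.{u} (Simp n)) n‖ₑ = 0) (A : Set X)
    (α : (singularNormed.{u}.relCplx A).Homology n) : α = 0 := by
  rw [← 𝓜.mapHomology_φ_ψ_rel A α,
    (𝓜.ψ.relHom A).mapHomology_eq_zero n (relApp_eq_zero_of_enorm_eq_zero hψ A) α]
  exact map_zero _

theorem relApp_eq_zero_mono {A B : Set X} (hAB : A ⊆ B) (h : ∀ c, 𝓜.φ.relApp A n c = 0)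
    (c : 𝓜.F.Rel X B n) : 𝓜.φ.relApp B n c = 0 := by
  obtain ⟨b, rfl⟩ := Submodule.Quotient.mk_surjective _ c
  have hb := 𝓜.φ.relIncl_relApp hAB n (Submodule.Quotient.mk b : 𝓜.F.Rel X A n)
  rw [h] at hb
  exact hb.symm.trans (map_zero _)

theorem opENorm_lfApp_ne_top (φ : NatContChainMap 𝓜.F singularNormed.{u}) :
    opENorm (lfNorm X 𝓜.F n) (lfL1Norm X n) (φ.lfApp X n) ≠ ∞ :=
  ne_top_of_le_ne_top (by simp : ‖φ.app X n‖ₑ + 1 ≠ ∞) (sInf_le (lfL1Norm_lfApp_le φ))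

/-- If the operator norm of `φ^lf` is zero, then `φ` maps every finite chain to a chain without
simplices through `x`. -/
theorem relApp_singleton_eq_zero
    (h : opENorm (lfNorm X 𝓜.F n) (lfL1Norm X n) (𝓜.φ.lfApp X n) = 0) (x : X)
    (c : 𝓜.F.Rel X {x}ᶜ n) : 𝓜.φ.relApp {x}ᶜ n c = 0 := by
  obtain ⟨b, rfl⟩ := Submodule.Quotient.mk_surjective _ c
  have hb : lfL1Norm X n (𝓜.φ.lfApp X n (toLF 𝓜.F b)) = 0 := by
    have := le_opENorm (opENorm_lfApp_ne_top 𝓜.φ) (toLF 𝓜.F b)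
      (Or.inr (ne_top_of_le_ne_top enorm_ne_top (lfNorm_toLF_le b)))
    rwa [h, zero_mul, nonpos_iff_eq_zero] at this
  refine (Submodule.Quotient.mk_eq_zero _).2 ((mem_sub_iff_coeff_eq_zero _ _).2 fun σ hσ => ?_)
  rw [coeff_eq_lfCoeff (𝓜.φ.lfApp X n (toLF 𝓜.F b)) {x} σ (by simpa using hσ) _ rfl]
  exact enorm_eq_zero.1 (ENNReal.tsum_eq_zero.1 hb σ)

end Vanishing

/-! ### Comparison of the volumes -/

namespace MOrientation

variable {n : ℕ} {M : Type u} [TopologicalSpace M] {o : MOrientation n M}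

/-- If the local homology of `M` vanishes, then every class restricts to the orientation. -/
theorem isRelFundamentalClass_zero
    (h : ∀ (x : mInterior n M) (β : (singularNormed.{u}.relCplx {(x : M)}ᶜ).Homology n), β = 0) :
    o.IsRelFundamentalClass 0 := fun x => (h x _).trans (h x _).symm

theorem isLfFundamentalClass_zero
    (h : ∀ (x : mInterior n M) (β : (singularNormed.{u}.relCplx {(x : M)}ᶜ).Homology n), β = 0) :
    o.IsLfFundamentalClass 0 := fun x => (h x _).trans (h x _).symm

variable (o) (𝓜 : NormedModel.{u, v})

theorem modelVolume_le :
    o.modelVolume 𝓜 ≤ ‖𝓜.ψ.app (ULift.{u} (Simp n)) n‖ₑ * o.simplicialVolume := by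
  refine biInf_le_mul_biInf enorm_ne_top (fun hψ => ⟨0, ?_, ?_⟩) fun hψ α _ => ?_
  · exact isRelFundamentalClass_zero fun x => homology_eq_zero_of_ψ_eq_zero hψ _
  · rw [map_zero]
    exact Cplx.homologyNorm_zero n _ (enorm_rel_zero _)
  · exact (𝓜.ψ.relHom _).homologyNorm_le n hψ enorm_ne_top (enorm_relApp_le 𝓜.ψ _) rfl

/-- If the factor vanishes, then `φ` is zero on `F_n(M, M \ {x})` for all interior points `x`, as
these modules are quotients of `F_n(M, ∂M)`. -/
theorem simplicialVolume_le :
    o.simplicialVolume ≤ ‖𝓜.φ.relApp (mBoundary n M) n‖ₑ * o.modelVolume 𝓜 := by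
  refine biInf_le_mul_biInf enorm_ne_top (fun hφ => ⟨0, ?_, ?_⟩) fun hφ α _ => ?_
  · refine isRelFundamentalClass_zero fun x => homology_eq_zero_of_φ_eq_zero (𝓜 := 𝓜)
      (relApp_eq_zero_mono (boundary_subset x) fun c => rel_eq_zero_of_norm_eq_zero ?_)
    have h := (𝓜.φ.relApp (mBoundary n M) n).le_opNorm c
    rw [← toReal_enorm (𝓜.φ.relApp (mBoundary n M) n), hφ, ENNReal.toReal_zero, zero_mul] at h
    exact le_antisymm h (norm_nonneg _)
  · exact Cplx.homologyNorm_zero n _ (enorm_rel_zero _)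
  · exact (𝓜.φ.relHom _).homologyNorm_le n hφ enorm_ne_top (𝓜.φ.relApp _ n).le_opENorm
      (𝓜.mapHomology_φ_ψ_rel _ α)

theorem lfModelVolume_le :
    o.lfModelVolume 𝓜 ≤ ‖𝓜.ψ.app (ULift.{u} (Simp n)) n‖ₑ * o.lfSimplicialVolume := by
  refine biInf_le_mul_biInf enorm_ne_top (fun hψ => ⟨0, ?_, ?_⟩) fun hψ α _ => ?_
  · exact isLfFundamentalClass_zero fun x => homology_eq_zero_of_ψ_eq_zero hψ _
  · rw [map_zero]
    exact Cplx.homologyNorm_zero n _ lfNorm_zero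
  · exact (𝓜.ψ.lfHom M).homologyNorm_le n hψ enorm_ne_top (lfNorm_lfApp_le 𝓜.ψ hψ) rfl

theorem lfSimplicialVolume_le :
    o.lfSimplicialVolume ≤
      opENorm (lfNorm M 𝓜.F n) (lfL1Norm M n) (𝓜.φ.lfApp M n) * o.lfModelVolume 𝓜 := by
  refine biInf_le_mul_biInf (opENorm_lfApp_ne_top 𝓜.φ) (fun hφ => ⟨0, ?_, ?_⟩) fun hφ α _ => ?_
  · exact isLfFundamentalClass_zero fun x =>
      homology_eq_zero_of_φ_eq_zero (relApp_singleton_eq_zero hφ x)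
  · exact Cplx.homologyNorm_zero n _ lfL1Norm_zero
  · exact (𝓜.φ.lfHom M).homologyNorm_le n hφ (opENorm_lfApp_ne_top 𝓜.φ)
      (fun c => le_opENorm (opENorm_lfApp_ne_top 𝓜.φ) c (Or.inl hφ)) (𝓜.mapHomology_φ_ψ_lf α)

end MOrientation

end NormedModels

end

theorem proposition3 (𝓜 : NormedModels.NormedModel.{u, v}) (n : ℕ) :
    -- compact oriented manifolds, possibly with boundary
    (∀ (M : Type u) [TopologicalSpace M] [CompactSpace M],
      NormedModels.IsTopManifold n M → ∀ o : NormedModels.MOrientation n M,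
        o.modelVolume 𝓜 ≤
          ‖𝓜.ψ.app (ULift.{u} (NormedModels.Simp n)) n‖ₑ * o.simplicialVolume ∧
        o.simplicialVolume ≤
          ‖𝓜.φ.relApp (NormedModels.mBoundary n M) n‖ₑ * o.modelVolume 𝓜) ∧
    -- oriented manifolds without boundary, not necessarily compact
    (∀ (M : Type u) [TopologicalSpace M],
      NormedModels.IsTopManifold n M → NormedModels.mBoundary n M = ∅ →
        ∀ o : NormedModels.MOrientation n M,
          o.lfModelVolume 𝓜 ≤
            ‖𝓜.ψ.app (ULift.{u} (NormedModels.Simp n)) n‖ₑ * o.lfSimplicialVolume ∧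
          NormedModels.opENorm (NormedModels.lfNorm M 𝓜.F n) (NormedModels.lfL1Norm M n)
            (𝓜.φ.lfApp M n) ≠ ∞ ∧
          o.lfSimplicialVolume ≤
            NormedModels.opENorm (NormedModels.lfNorm M 𝓜.F n) (NormedModels.lfL1Norm M n)
              (𝓜.φ.lfApp M n) * o.lfModelVolume 𝓜) := by
  refine ⟨fun M _ _ _ o => ⟨o.modelVolume_le 𝓜, o.simplicialVolume_le 𝓜⟩, fun M _ _ _ o =>
    ⟨o.lfModelVolume_le 𝓜, NormedModels.opENorm_lfApp_ne_top 𝓜.φ, o.lfSimplicialVolume_le 𝓜⟩⟩
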